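/- Let $(M,g)$ be a spacetime, i.e. a smooth (Hausdorff, second countable, finite-dimensional) manifold $M$ without boundary, with a smooth Lorentzian metric $g$ of signature $(-,+,\dots,+)$ and a time-orientation, given by a continuous timelike vector field declared future-directed. A nonzero tangent vector $v$ is called timelike if $g(v,v)<0$, null if $g(v,v)=0$, and causal if it is timelike or null. A causal vector is future-directed (past-directed) if it lies in the same causal cone as the time-orienting field (in the opposite one). A smooth function $f\colon M\to\mathbb{R}$ is called a quasi-time function if (i) its gradient $\nabla f$, defined by $g(\nabla f,\cdot)=df$, is everywhere nonzero, causal and past-directed, and (ii) every null geodesic segment $\gamma\colon[a,b]\to M$, $a<b$ (a geodesic of the Levi-Civita connection whose velocity is everywhere null, in particular nonzero), such that $f\circ\gamma$ is constant, is injective. Then: if $(M,g)$ admits a quasi-time function, $(M,g)$ is causal, i.e. it contains no closed causal curve: there is no piecewise $C^1$ curve $\gamma\colon[a,b]\to M$, $a<b$, with $\gamma(a)=\gamma(b)$ whose velocity (one-sided at break points and end points) is everywhere causal and future-directed. -/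

import Mathlib

open Set
open scoped Manifold ContDiff Bundle

namespace QuasiTime

section Definitions

variable {E : Type*} [NormedAddCommGroup E] [NormedSpace ℝ E]
  {M : Type*} [TopologicalSpace M] [ChartedSpace E M] [IsManifold 𝓘(ℝ, E) ∞ M]

/-- A smooth Lorentzian metric of signature `(-,+,…,+)` on a smooth manifold `M` modelled on `E`:
a smooth field of symmetric bilinear forms on the tangent spaces such that each of them is negative
on some vector `v` and positive definite on the orthogonal complement of `v`. -/
structure LorentzMetric (E : Type*) [NormedAddCommGroup E] [NormedSpace ℝ E]
    (M : Type*) [TopologicalSpace M] [ChartedSpace E M] [IsManifold 𝓘(ℝ, E) ∞ M] where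
  /-- The bilinear form on each tangent space. -/
  inner (x : M) : TangentSpace 𝓘(ℝ, E) x →L[ℝ] TangentSpace 𝓘(ℝ, E) x →L[ℝ] ℝ
  symm (x : M) (v w : TangentSpace 𝓘(ℝ, E) x) : inner x v w = inner x w v
  signature (x : M) : ∃ v : TangentSpace 𝓘(ℝ, E) x, inner x v v < 0 ∧
    ∀ w : TangentSpace 𝓘(ℝ, E) x, inner x v w = 0 → w ≠ 0 → 0 < inner x w w
  contMDiff : ContMDiff 𝓘(ℝ, E) (𝓘(ℝ, E).prod 𝓘(ℝ, E →L[ℝ] E →L[ℝ] ℝ)) ∞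
    (fun x : M ↦ Bundle.TotalSpace.mk' (E →L[ℝ] E →L[ℝ] ℝ)
      (E := fun x : M ↦ TangentSpace 𝓘(ℝ, E) x →L[ℝ] TangentSpace 𝓘(ℝ, E) x →L[ℝ] ℝ)
      x (inner x))

variable (g : LorentzMetric E M)

/-- A tangent vector is timelike if `g(v,v) < 0`. -/
def IsTimelike {x : M} (v : TangentSpace 𝓘(ℝ, E) x) : Prop :=
  g.inner x v v < 0

/-- A tangent vector is null (lightlike) if it is nonzero and `g(v,v) = 0`. -/
def IsNull {x : M} (v : TangentSpace 𝓘(ℝ, E) x) : Prop :=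
  v ≠ 0 ∧ g.inner x v v = 0

/-- A tangent vector is causal if it is timelike or null. -/
def IsCausalVector {x : M} (v : TangentSpace 𝓘(ℝ, E) x) : Prop :=
  IsTimelike g v ∨ IsNull g v

/-- A time-orientation, given by a continuous timelike vector field (declared future-directed). -/
structure TimeOrientation where
  /-- The timelike vector field that singles out the future cones. -/
  field (x : M) : TangentSpace 𝓘(ℝ, E) x
  continuous_field : Continuous (fun x ↦ (⟨x, field x⟩ : TangentBundle 𝓘(ℝ, E) M))
  timelike (x : M) : IsTimelike g (field x)

variable {g}

/-- A causal vector is future-directed if it lies in the same causal cone as the time-orientation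
field `T`; in signature `(-,+,…,+)` this means `g(T,v) < 0`. -/
def TimeOrientation.FutureCausal (T : TimeOrientation g) {x : M}
    (v : TangentSpace 𝓘(ℝ, E) x) : Prop :=
  IsCausalVector g v ∧ g.inner x (T.field x) v < 0

/-- A causal vector is past-directed if it lies in the causal cone opposite to that of the
time-orientation field `T`. -/
def TimeOrientation.PastCausal (T : TimeOrientation g) {x : M}
    (v : TangentSpace 𝓘(ℝ, E) x) : Prop :=
  IsCausalVector g v ∧ 0 < g.inner x (T.field x) v

/-- The velocity `γ'(t)` of a curve relative to a set `s` of parameters (one-sided at the end points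
if `s` is a closed interval). -/
noncomputable def velocity (γ : ℝ → M) (s : Set ℝ) (t : ℝ) : TangentSpace 𝓘(ℝ, E) (γ t) :=
  mfderivWithin 𝓘(ℝ, ℝ) 𝓘(ℝ, E) γ s t (1 : ℝ)

/-- `γ : [a,b] → M` is a future-directed piecewise `C¹` causal curve: there is a partition
`a = t₀ < t₁ < … < tₙ = b` such that on every closed piece `[tᵢ, tᵢ₊₁]` the curve is `C¹` and its
velocity is everywhere (one-sidedly at the end points) a future-directed causal vector. -/
def IsFutureCausalCurve (T : TimeOrientation g) (γ : ℝ → M) (a b : ℝ) : Prop :=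
  ∃ (n : ℕ) (t : ℕ → ℝ), t 0 = a ∧ t n = b ∧ ∀ i < n, t i < t (i + 1) ∧
    ContMDiffOn 𝓘(ℝ, ℝ) 𝓘(ℝ, E) 1 γ (Icc (t i) (t (i + 1))) ∧
    ∀ r ∈ Icc (t i) (t (i + 1)), T.FutureCausal (velocity γ (Icc (t i) (t (i + 1))) r)

/-- A time-oriented Lorentzian manifold is causal if it contains no closed causal curve. -/
def IsCausal (T : TimeOrientation g) : Prop :=
  ¬ ∃ (γ : ℝ → M) (a b : ℝ), a < b ∧ IsFutureCausalCurve T γ a b ∧ γ a = γ b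

/-! ### Gradient -/

/-- Nondegeneracy of a Lorentzian metric. -/
theorem LorentzMetric.nondegenerate (g : LorentzMetric E M) (x : M)
    (v : TangentSpace 𝓘(ℝ, E) x) (h : ∀ w, g.inner x v w = 0) : v = 0 := by
  obtain ⟨u, -, hu⟩ := g.signature x
  by_contra hv
  exact (hu v (by rw [g.symm, h]) hv).ne' (h v)

/-- The Riesz representation of covectors by a Lorentzian metric. -/
theorem LorentzMetric.exists_unique_dual [FiniteDimensional ℝ E] (g : LorentzMetric E M) (x : M)
    (φ : TangentSpace 𝓘(ℝ, E) x →L[ℝ] ℝ) :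
    ∃! v : TangentSpace 𝓘(ℝ, E) x, ∀ w, g.inner x v w = φ w := by
  have : FiniteDimensional ℝ (TangentSpace 𝓘(ℝ, E) x) := inferInstanceAs (FiniteDimensional ℝ E)
  let L : TangentSpace 𝓘(ℝ, E) x →ₗ[ℝ] Module.Dual ℝ (TangentSpace 𝓘(ℝ, E) x) :=
    { toFun := fun v ↦ (g.inner x v).toLinearMap
      map_add' := fun v w ↦ by ext; simp
      map_smul' := fun c v ↦ by ext; simp }
  have hinj : Function.Injective L := by
    rw [injective_iff_map_eq_zero]
    intro v hv
    exact g.nondegenerate x v fun w ↦ LinearMap.congr_fun hv w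
  have hsurj : Function.Surjective L :=
    (LinearMap.injective_iff_surjective_of_finrank_eq_finrank
      (Subspace.dual_finrank_eq (K := ℝ)).symm).1 hinj
  obtain ⟨v, hv⟩ := hsurj φ.toLinearMap
  refine ⟨v, fun w ↦ LinearMap.congr_fun hv w, fun v' hv' ↦ hinj ?_⟩
  rw [hv]
  exact LinearMap.ext hv'

/-- The gradient `∇f` of a function: the unique vector field with `g(∇f, w) = df(w)`. -/
noncomputable def gradient [FiniteDimensional ℝ E] (g : LorentzMetric E M) (f : M → ℝ) (x : M) :
    TangentSpace 𝓘(ℝ, E) x :=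
  (g.exists_unique_dual x (mfderiv 𝓘(ℝ, E) 𝓘(ℝ, ℝ) f x)).choose

theorem inner_gradient [FiniteDimensional ℝ E] (g : LorentzMetric E M) (f : M → ℝ) (x : M)
    (w : TangentSpace 𝓘(ℝ, E) x) :
    g.inner x (gradient g f x) w = (mfderiv 𝓘(ℝ, E) 𝓘(ℝ, ℝ) f x w : ℝ) :=
  (g.exists_unique_dual x (mfderiv 𝓘(ℝ, E) 𝓘(ℝ, ℝ) f x)).choose_spec.1 w

/-! ### Geodesics -/

/-- The metric in the coordinates of a chart `e`, i.e. the pull-back of `g` by the inverse chart: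
at `x ∈ e.target` this is the bilinear form `(u, v) ↦ g(De⁻¹ u, De⁻¹ v)` on the model space. -/
noncomputable def metricInChart (g : LorentzMetric E M) (e : OpenPartialHomeomorph M E) (x : E) :
    E →L[ℝ] E →L[ℝ] ℝ :=
  let B : E →L[ℝ] E →L[ℝ] ℝ := g.inner (e.symm x)
  let D : E →L[ℝ] E := mfderiv 𝓘(ℝ, E) 𝓘(ℝ, E) e.symm x
  B.bilinearComp D D

/-- The Christoffel symbols of the first kind of the Levi-Civita connection in a chart, as a
trilinear form: `Γ(u,v;w) = ½ (∂_u g(v,w) + ∂_v g(u,w) - ∂_w g(u,v))`. -/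
noncomputable def christoffel (g : LorentzMetric E M) (e : OpenPartialHomeomorph M E) (x : E)
    (u v w : E) : ℝ :=
  (1 / 2) * (fderiv ℝ (metricInChart g e) x u v w + fderiv ℝ (metricInChart g e) x v u w
    - fderiv ℝ (metricInChart g e) x w u v)

/-- `γ` is a geodesic on the (nondegenerate) interval `s`: it is `C²` there, and in every chart of
the smooth structure its coordinate expression `c = e ∘ γ` satisfies the geodesic equation
`c'' + Γ(c', c') = 0`, written here with the index lowered by the (nondegenerate) metric:
`g(c'', w) + Γ(c', c'; w) = 0` for all `w`. Such curves are automatically smooth. -/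
def IsGeodesicOn (g : LorentzMetric E M) (γ : ℝ → M) (s : Set ℝ) : Prop :=
  ContMDiffOn 𝓘(ℝ, ℝ) 𝓘(ℝ, E) 2 γ s ∧
    ∀ e ∈ IsManifold.maximalAtlas 𝓘(ℝ, E) ∞ M, ∀ t ∈ s, γ t ∈ e.source → ∀ w : E,
      let c : ℝ → E := fun r ↦ e (γ r)
      metricInChart g e (c t) (derivWithin (derivWithin c s) s t) w
        + christoffel g e (c t) (derivWithin c s t) (derivWithin c s t) w = 0

/-- A null geodesic: a geodesic whose velocity is everywhere null (in particular nonzero). -/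
def IsNullGeodesicOn (g : LorentzMetric E M) (γ : ℝ → M) (s : Set ℝ) : Prop :=
  IsGeodesicOn g γ s ∧ ∀ t ∈ s, IsNull g (velocity γ s t)

/-- A quasi-time function: a smooth function `f` such that `∇f` is everywhere nonzero, causal and
past-directed, and such that every null geodesic segment `γ : [a,b] → M` along which `f` is
constant is injective. -/
structure IsQuasiTimeFunction [FiniteDimensional ℝ E] (T : TimeOrientation g) (f : M → ℝ) :
    Prop where
  smooth : ContMDiff 𝓘(ℝ, E) 𝓘(ℝ, ℝ) ∞ f
  gradient_ne_zero (x : M) : gradient g f x ≠ 0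
  gradient_pastCausal (x : M) : T.PastCausal (gradient g f x)
  injOn_of_isNullGeodesicOn (γ : ℝ → M) (a b : ℝ) (hab : a < b)
    (hγ : IsNullGeodesicOn g γ (Icc a b)) (hf : ∃ k : ℝ, ∀ t ∈ Icc a b, f (γ t) = k) :
    InjOn γ (Icc a b)

end Definitions

end QuasiTime

/-! A past-directed causal vector `p` and a future-directed causal vector `v` satisfy `g(p,v) ≥ 0`,
with equality only if both are null and proportional. Hence `f` is nondecreasing along
future-directed causal curves. On a closed one it must be constant, so at each parameter `∇f` is
null and the velocity is a negative multiple of `∇f`. Up to reparametrization the curve is an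
integral curve of `-∇f = ∇(-f)`. Corners disappear in the process, because the velocities of
adjacent pieces at a break point are values of one vector field.

Such an integral curve is a geodesic. Indeed `∇_{∇f} ∇f = ½ ∇(g(∇f,∇f))` by symmetry of the Hessian,
and `g(∇f,∇f) ≤ 0` is maximal wherever `∇f` is null, so the right-hand side vanishes there. The
closed curve thus becomes a null geodesic segment with `f` constant and equal end points, which
condition (ii) forbids.

The pointwise algebra is `TimeOrientation.PastCausal.eq_smul_of_inner_nonpos`, the geodesic equation
rests on `gradient_geodesic_identity`, and the pieces are joined by
`exists_isMIntegralCurveOn_of_chain`. -/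

namespace QuasiTime

/-! ### Causal vectors in a single tangent space -/

section PointwiseAlgebra

variable {E : Type*} [NormedAddCommGroup E] [NormedSpace ℝ E]
  {M : Type*} [TopologicalSpace M] [ChartedSpace E M] [IsManifold 𝓘(ℝ, E) ∞ M]
  {g : LorentzMetric E M} {x : M}

/-- A Lorentzian metric is positive definite on the orthogonal complement of any timelike vector. -/
theorem IsTimelike.inner_self_pos {u w : TangentSpace 𝓘(ℝ, E) x} (hu : IsTimelike g u)
    (huw : g.inner x u w = 0) (hw : w ≠ 0) : 0 < g.inner x w w := by
  obtain ⟨v, hv, hpos⟩ := g.signature x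
  have hu' : g.inner x u u < 0 := hu
  by_contra! hle
  have hvu : g.inner x v u ≠ 0 := fun h0 ↦ by
    have hu0 : u ≠ 0 := by rintro rfl; simp at hu'
    exact absurd (hpos u h0 hu0) (not_lt.2 hu'.le)
  have hwu : g.inner x w u = 0 := by rw [g.symm, huw]
  -- This combination is orthogonal to `v`, so its square must be positive; but `g(u,w) = 0` makes
  -- the square `g(v,w)² g(u,u) + g(v,u)² g(w,w) ≤ 0`.
  have hne : g.inner x v w • u - g.inner x v u • w ≠ 0 := fun h0 ↦ by
    have h1 := congrArg (g.inner x u) h0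
    simp only [map_sub, map_smul, huw, smul_eq_mul, mul_zero, sub_zero, map_zero] at h1
    have h2 : g.inner x v w = 0 := by
      rcases mul_eq_zero.1 h1 with h | h
      · exact h
      · exact absurd h hu'.ne
    rw [h2, zero_smul, zero_sub, neg_eq_zero] at h0
    rcases smul_eq_zero.1 h0 with h | h
    · exact hvu h
    · exact hw h
  have := hpos _ (by simp; ring) hne
  simp only [map_sub, map_smul, sub_apply, smul_apply,
    huw, hwu, smul_eq_mul, mul_zero, sub_zero, zero_sub] at this
  nlinarith [mul_nonneg (sq_nonneg (g.inner x v w)) (neg_nonneg.2 hu'.le),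
    mul_nonneg (sq_nonneg (g.inner x v u)) (neg_nonneg.2 hle)]

theorem IsCausalVector.inner_self_nonpos {v : TangentSpace 𝓘(ℝ, E) x} (hv : IsCausalVector g v) :
    g.inner x v v ≤ 0 := by
  rcases hv with h | h
  · exact le_of_lt h
  · exact h.2.le

variable {T : TimeOrientation g} {p v : TangentSpace 𝓘(ℝ, E) x}

/-- If a past-directed and a future-directed causal vector have nonpositive scalar product, then they
are linearly dependent and null. -/
theorem TimeOrientation.PastCausal.eq_smul_of_inner_nonpos (hp : T.PastCausal p)
    (hv : T.FutureCausal v) (h : g.inner x p v ≤ 0) :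
    g.inner x p p = 0 ∧ g.inner x p v = 0 ∧
      v = (g.inner x (T.field x) v / g.inner x (T.field x) p) • p := by
  have hpp := hp.1.inner_self_nonpos
  have hvv := hv.1.inner_self_nonpos
  have hTp := hp.2
  have hTv := hv.2
  have hvp : g.inner x v p = g.inner x p v := g.symm _ _ _
  set α := g.inner x (T.field x) p
  set β := g.inner x (T.field x) v
  -- The vector `βp - αv` is orthogonal to `T`, hence spacelike or zero. Since `αβ < 0`, all three
  -- terms of its square are nonpositive, so the vector and each term vanish.
  have hexp : g.inner x (β • p - α • v) (β • p - α • v)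
      = β ^ 2 * g.inner x p p + α ^ 2 * g.inner x v v - 2 * (α * β) * g.inner x p v := by
    simp only [map_sub, map_smul, sub_apply, smul_apply,
      smul_eq_mul, hvp]
    ring
  have hαβ : α * β < 0 := mul_neg_of_pos_of_neg hTp hTv
  have h1 : 0 ≤ -(β ^ 2 * g.inner x p p) := by nlinarith [sq_nonneg β]
  have h2 : 0 ≤ -(α ^ 2 * g.inner x v v) := by nlinarith [sq_nonneg α]
  have h3 : 0 ≤ α * β * g.inner x p v := by nlinarith
  have hzero : β • p - α • v = 0 := by
    by_contra hne
    have := IsTimelike.inner_self_pos (T.timelike x) (w := β • p - α • v)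
      (by simp only [map_sub, map_smul, smul_eq_mul]; exact sub_eq_zero.2 (mul_comm _ _)) hne
    linarith
  rw [hzero, map_zero] at hexp
  have h4 : β ^ 2 * g.inner x p p = 0 := by linarith
  have h5 : α * β * g.inner x p v = 0 := by linarith
  refine ⟨(mul_eq_zero.1 h4).resolve_left (pow_ne_zero 2 hTv.ne),
    (mul_eq_zero.1 h5).resolve_left hαβ.ne, ?_⟩
  rw [div_eq_inv_mul, mul_smul, sub_eq_zero.1 hzero, smul_smul, inv_mul_cancel₀ hTp.ne', one_smul]

theorem TimeOrientation.PastCausal.inner_nonneg (hp : T.PastCausal p) (hv : T.FutureCausal v) :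
    0 ≤ g.inner x p v := by
  by_contra! h
  exact h.ne (hp.eq_smul_of_inner_nonpos hv h.le).2.1

end PointwiseAlgebra

/-! ### Gradient and geodesic equation in a chart -/

section ChartCalculus

/-- Regularity of the solutions of an autonomous ODE. -/
theorem contDiffWithinAt_two_of_hasDerivWithinAt {E : Type*} [NormedAddCommGroup E]
    [NormedSpace ℝ E] {V : E → E} {c : ℝ → E} {s : Set ℝ} {t : ℝ} (ht : t ∈ s)
    (hV : ContDiffAt ℝ 1 V (c t)) (hc : ∀ r ∈ s, HasDerivWithinAt c (V (c r)) s r) :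
    ContDiffWithinAt ℝ 2 c s t := by
  -- Bootstrap: `c' = V ∘ c` is as regular as `c`, up to the order of `V`.
  have step (k : ℕ) (hk : k ≤ 1) (h : ContDiffWithinAt ℝ k c s t) :
      ContDiffWithinAt ℝ (k + 1) c s t := by
    rw [contDiffWithinAt_succ_iff_hasFDerivWithinAt (by simp)]
    refine ⟨s, by rw [insert_eq_of_mem ht]; exact self_mem_nhdsWithin, by simp,
      fun r ↦ (1 : ℝ →L[ℝ] ℝ).smulRight (V (c r)), fun r hr ↦ ?_, ?_⟩
    · simpa using! (hc r hr).hasFDerivWithinAt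
    · exact contDiffWithinAt_const.smulRight
        ((hV.of_le (by exact_mod_cast hk)).comp_contDiffWithinAt t h)
  have h0 : ContDiffWithinAt ℝ (0 : ℕ) c s t := by
    rw [Nat.cast_zero, contDiffWithinAt_zero ht]
    refine ⟨s, self_mem_nhdsWithin, ?_⟩
    rw [inter_self]
    exact fun r hr ↦ (hc r hr).continuousWithinAt
  have := step 1 le_rfl (by simpa using! step 0 zero_le_one h0)
  simpa [one_add_one_eq_two] using! this

/-- The geodesic equation for a gradient field `V` at a local maximum of `G(V, V)`. -/
theorem gradient_geodesic_identity {E : Type*} [NormedAddCommGroup E] [NormedSpace ℝ E]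
    {G : E → E →L[ℝ] E →L[ℝ] ℝ} {V : E → E} {φ : E → ℝ} {y : E}
    (hG : DifferentiableAt ℝ G y) (hV : DifferentiableAt ℝ V y) (hφ : ContDiffAt ℝ 2 φ y)
    (hsymm : ∀ u v, G y u v = G y v u)
    (hGV : ∀ᶠ z in nhds y, ∀ w, G z (V z) w = fderiv ℝ φ z w)
    (hmax : IsLocalMax (fun z ↦ G z (V z) (V z)) y) (w : E) :
    G y (fderiv ℝ V y (V y)) w + fderiv ℝ G y (V y) (V y) w
      = (1 / 2) * fderiv ℝ G y w (V y) (V y) := by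
  have hGd := hG.hasFDerivAt.clm_apply hV.hasFDerivAt
  have hφ' : HasFDerivAt (fderiv ℝ φ) (fderiv ℝ (fderiv ℝ φ) y) y :=
    ((hφ.fderiv_right (m := 1) (by norm_num)).differentiableAt (by simp)).hasFDerivAt
  have hDeriv := (hφ'.congr_of_eventuallyEq (f₁ := fun z ↦ G z (V z))
    (hGV.mono fun z hz ↦ ContinuousLinearMap.ext hz)).unique hGd
  have hDz (z w : E) : fderiv ℝ (fderiv ℝ φ) y z w
      = G y (fderiv ℝ V y z) w + fderiv ℝ G y z (V y) w := by
    have := DFunLike.congr_fun (DFunLike.congr_fun hDeriv z) w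
    simpa using this
  have hh := DFunLike.congr_fun
    (hmax.hasFDerivAt_eq_zero (hGd.clm_apply hV.hasFDerivAt)) w
  have hzero : G y (V y) (fderiv ℝ V y w)
      + (G y (fderiv ℝ V y w) (V y) + fderiv ℝ G y w (V y) (V y)) = 0 := by
    simpa using hh
  -- Symmetry of `D²φ` exchanges `V` and `w`, giving `G(D_V V,w) + D_V G(V,w) = G(D_w V,V) + D_w
  -- G(V,V)`; the critical point condition `2 G(D_w V,V) = -D_w G(V,V)` eliminates `D_w V`.
  have h1 := hDz (V y) w
  rw [(hφ.isSymmSndFDerivAt (by simp)).eq, hDz w (V y)] at h1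
  rw [hsymm (V y)] at hzero
  linarith

variable {E : Type*} [NormedAddCommGroup E] [NormedSpace ℝ E]
  {M : Type*} [TopologicalSpace M] [ChartedSpace E M] {e : OpenPartialHomeomorph M E}

theorem mdifferentiable_of_mem_maximalAtlas
    (he : e ∈ IsManifold.maximalAtlas 𝓘(ℝ, E) ∞ M) :
    e.MDifferentiable 𝓘(ℝ, E) 𝓘(ℝ, E) :=
  ⟨(contMDiffOn_of_mem_maximalAtlas he).mdifferentiableOn (by simp),
    (contMDiffOn_symm_of_mem_maximalAtlas he).mdifferentiableOn (by simp)⟩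

theorem mfderiv_symm_mfderiv (he : e ∈ IsManifold.maximalAtlas 𝓘(ℝ, E) ∞ M) {y : E}
    (hy : y ∈ e.target) (v : TangentSpace 𝓘(ℝ, E) (e.symm y)) :
    mfderiv 𝓘(ℝ, E) 𝓘(ℝ, E) e.symm y (mfderiv 𝓘(ℝ, E) 𝓘(ℝ, E) e (e.symm y) v) = v := by
  have h := (mdifferentiable_of_mem_maximalAtlas he).symm_comp_deriv (e.map_target hy)
  rw [e.right_inv hy] at h
  exact DFunLike.congr_fun h v

theorem mfderiv_mfderiv_symm (he : e ∈ IsManifold.maximalAtlas 𝓘(ℝ, E) ∞ M) {y : E}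
    (hy : y ∈ e.target) (v : E) :
    mfderiv 𝓘(ℝ, E) 𝓘(ℝ, E) e (e.symm y) (mfderiv 𝓘(ℝ, E) 𝓘(ℝ, E) e.symm y v) = v := by
  have h := (mdifferentiable_of_mem_maximalAtlas he).comp_symm_deriv hy
  exact DFunLike.congr_fun h v

theorem contDiffOn_comp_symm {f : M → ℝ} (hf : ContMDiff 𝓘(ℝ, E) 𝓘(ℝ, ℝ) ∞ f)
    (he : e ∈ IsManifold.maximalAtlas 𝓘(ℝ, E) ∞ M) :
    ContDiffOn ℝ ∞ (fun y ↦ f (e.symm y)) e.target := by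
  rw [← contMDiffOn_iff_contDiffOn]
  exact hf.comp_contMDiffOn (contMDiffOn_symm_of_mem_maximalAtlas he)

variable [IsManifold 𝓘(ℝ, E) ∞ M] {g : LorentzMetric E M}

theorem metricInChart_apply (g : LorentzMetric E M) (e : OpenPartialHomeomorph M E) (y u v : E) :
    metricInChart g e y u v = g.inner (e.symm y)
      (mfderiv 𝓘(ℝ, E) 𝓘(ℝ, E) e.symm y u) (mfderiv 𝓘(ℝ, E) 𝓘(ℝ, E) e.symm y v) := rfl

theorem metricInChart_symm (g : LorentzMetric E M) (e : OpenPartialHomeomorph M E) (y u v : E) :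
    metricInChart g e y u v = metricInChart g e y v u := by
  rw [metricInChart_apply, metricInChart_apply, g.symm]

/-- The vector field along an inverse chart whose coordinate expression is constant. -/
theorem contMDiffOn_mfderiv_symm (he : e ∈ IsManifold.maximalAtlas 𝓘(ℝ, E) ∞ M) (u : E) :
    ContMDiffOn 𝓘(ℝ, E) 𝓘(ℝ, E).tangent ∞
      (fun y ↦ (⟨e.symm y, mfderiv 𝓘(ℝ, E) 𝓘(ℝ, E) e.symm y u⟩ : TangentBundle 𝓘(ℝ, E) M))
      e.target := by
  have h1 := (contMDiffOn_symm_of_mem_maximalAtlas he).contMDiffOn_tangentMapWithin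
    (m := ∞) (by simp) e.open_target.uniqueMDiffOn
  have h2 : ContMDiffOn 𝓘(ℝ, E) 𝓘(ℝ, E).tangent ∞
      (fun y ↦ (⟨y, u⟩ : TangentBundle 𝓘(ℝ, E) E)) e.target := by
    exact contMDiffOn_vectorSpace_iff_contDiffOn.2 (contDiffOn_const (c := u))
  refine (h1.comp h2 (fun y hy ↦ hy)).congr fun y hy ↦ ?_
  simp only [Function.comp_apply, tangentMapWithin]
  rw [mfderivWithin_of_isOpen e.open_target hy]

/-- The scalar product of two smooth vector fields along a map is smooth. -/
theorem LorentzMetric.contMDiffWithinAt_inner (g : LorentzMetric E M) {b : E → M}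
    {v w : ∀ y, TangentSpace 𝓘(ℝ, E) (b y)} {s : Set E} {y : E}
    (hv : ContMDiffWithinAt 𝓘(ℝ, E) 𝓘(ℝ, E).tangent ∞
      (fun y ↦ (⟨b y, v y⟩ : TangentBundle 𝓘(ℝ, E) M)) s y)
    (hw : ContMDiffWithinAt 𝓘(ℝ, E) 𝓘(ℝ, E).tangent ∞
      (fun y ↦ (⟨b y, w y⟩ : TangentBundle 𝓘(ℝ, E) M)) s y) :
    ContMDiffWithinAt 𝓘(ℝ, E) 𝓘(ℝ, ℝ) ∞ (fun y ↦ g.inner (b y) (v y) (w y)) s y := by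
  have hb : ContMDiffWithinAt 𝓘(ℝ, E) 𝓘(ℝ, E) ∞ b s y :=
    (Bundle.contMDiffWithinAt_totalSpace.1 hv).1
  have : ContMDiffWithinAt 𝓘(ℝ, E) (𝓘(ℝ, E).prod 𝓘(ℝ)) ∞
      (fun y ↦ Bundle.TotalSpace.mk' ℝ (E := Bundle.Trivial M ℝ) (b y)
        (g.inner (b y) (v y) (w y))) s y := by
    apply ContMDiffWithinAt.clm_bundle_apply₂ (F₁ := E) (F₂ := E)
    · exact ContMDiffAt.comp_contMDiffWithinAt y g.contMDiff.contMDiffAt hb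
    · exact hv
    · exact hw
  exact (Bundle.contMDiffWithinAt_totalSpace.1 this).2

/-- In finite dimension, smoothness of an operator-valued map can be tested on fixed vectors; these
correspond to the coordinate fields along the inverse chart. -/
theorem contDiffOn_metricInChart [FiniteDimensional ℝ E] (g : LorentzMetric E M)
    (he : e ∈ IsManifold.maximalAtlas 𝓘(ℝ, E) ∞ M) :
    ContDiffOn ℝ ∞ (metricInChart g e) e.target := by
  refine contDiffOn_clm_apply.2 fun u ↦ contDiffOn_clm_apply.2 fun v y hy ↦ ?_
  exact contMDiffWithinAt_iff_contDiffWithinAt.1 (g.contMDiffWithinAt_inner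
    (contMDiffOn_mfderiv_symm he u y hy) (contMDiffOn_mfderiv_symm he v y hy))

theorem metricInChart_nondegenerate (g : LorentzMetric E M)
    (he : e ∈ IsManifold.maximalAtlas 𝓘(ℝ, E) ∞ M) {y : E}
    (hy : y ∈ e.target) {u : E} (h : ∀ w, metricInChart g e y u w = 0) : u = 0 := by
  have h0 : mfderiv 𝓘(ℝ, E) 𝓘(ℝ, E) e.symm y u = 0 := by
    refine g.nondegenerate _ _ fun w ↦ ?_
    rw [← mfderiv_symm_mfderiv he hy w]
    exact h (mfderiv 𝓘(ℝ, E) 𝓘(ℝ, E) e (e.symm y) w)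
  have := mfderiv_mfderiv_symm he hy u
  rw [h0, map_zero] at this
  exact this.symm

/-- The gradient in the coordinates of a chart. -/
noncomputable def gradientInChart [FiniteDimensional ℝ E] (g : LorentzMetric E M) (f : M → ℝ)
    (e : OpenPartialHomeomorph M E) (y : E) : E :=
  mfderiv 𝓘(ℝ, E) 𝓘(ℝ, E) e (e.symm y) (gradient g f (e.symm y))

variable [FiniteDimensional ℝ E] {f : M → ℝ}

theorem metricInChart_gradientInChart (g : LorentzMetric E M)
    (hf : ContMDiff 𝓘(ℝ, E) 𝓘(ℝ, ℝ) ∞ f)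
    (he : e ∈ IsManifold.maximalAtlas 𝓘(ℝ, E) ∞ M) {y : E} (hy : y ∈ e.target) (w : E) :
    metricInChart g e y (gradientInChart g f e y) w = fderiv ℝ (fun y ↦ f (e.symm y)) y w := by
  rw [metricInChart_apply, gradientInChart, mfderiv_symm_mfderiv he hy, inner_gradient,
    ← mfderiv_eq_fderiv]
  have := mfderiv_comp (I := 𝓘(ℝ, E)) (I' := 𝓘(ℝ, E)) (I'' := 𝓘(ℝ, ℝ)) y
    (hf.mdifferentiable (by simp) (e.symm y))
    ((mdifferentiable_of_mem_maximalAtlas he).mdifferentiableAt_symm hy)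
  exact (DFunLike.congr_fun this w).symm

theorem metricInChart_gradientInChart_self (g : LorentzMetric E M)
    (he : e ∈ IsManifold.maximalAtlas 𝓘(ℝ, E) ∞ M) {y : E} (hy : y ∈ e.target) :
    metricInChart g e y (gradientInChart g f e y) (gradientInChart g f e y)
      = g.inner (e.symm y) (gradient g f (e.symm y)) (gradient g f (e.symm y)) := by
  rw [metricInChart_apply, gradientInChart, mfderiv_symm_mfderiv he hy]

/-- The coordinate gradient is the inverse metric applied to the differential of `f ∘ e⁻¹`, and
inversion of operators is smooth at invertible ones. -/
theorem contDiffOn_gradientInChart (g : LorentzMetric E M)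
    (hf : ContMDiff 𝓘(ℝ, E) 𝓘(ℝ, ℝ) ∞ f)
    (he : e ∈ IsManifold.maximalAtlas 𝓘(ℝ, E) ∞ M) :
    ContDiffOn ℝ ∞ (gradientInChart g f e) e.target := by
  have hcomplete : CompleteSpace E := FiniteDimensional.complete ℝ E
  have hequiv (y : E) (hy : y ∈ e.target) :
      ∃ L : E ≃L[ℝ] (E →L[ℝ] ℝ), (L : E →L[ℝ] (E →L[ℝ] ℝ)) = metricInChart g e y := by
    have hinj : Function.Injective (metricInChart g e y : E →ₗ[ℝ] (E →L[ℝ] ℝ)) := by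
      rw [injective_iff_map_eq_zero]
      exact fun u hu ↦ metricInChart_nondegenerate g he hy fun w ↦ DFunLike.congr_fun hu w
    have hdim : Module.finrank ℝ E = Module.finrank ℝ (E →L[ℝ] ℝ) := by
      rw [← (LinearMap.toContinuousLinearMap (𝕜 := ℝ) (E := E) (F' := ℝ)).finrank_eq]
      exact (Subspace.dual_finrank_eq (K := ℝ)).symm
    refine ⟨(LinearEquiv.ofInjectiveOfFinrankEq _ hinj hdim).toContinuousLinearEquiv, ?_⟩
    ext u w
    rfl
  have hfd : ContDiffOn ℝ ∞ (fderiv ℝ (fun y ↦ f (e.symm y))) e.target :=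
    (contDiffOn_comp_symm hf he).fderiv_of_isOpen e.open_target (by simp)
  have hsmooth : ContDiffOn ℝ ∞ (fun y ↦ (metricInChart g e y).inverse
      (fderiv ℝ (fun y ↦ f (e.symm y)) y)) e.target := by
    refine ContDiffOn.clm_apply (fun y hy ↦ ?_) hfd
    obtain ⟨L, hL⟩ := hequiv y hy
    have := contDiffAt_map_inverse (𝕜 := ℝ) (n := ∞) L
    rw [hL] at this
    exact this.comp_contDiffWithinAt y (contDiffOn_metricInChart g he y hy)
  refine hsmooth.congr fun y hy ↦ ?_
  obtain ⟨L, hL⟩ := hequiv y hy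
  rw [← hL, ContinuousLinearMap.inverse_equiv]
  refine L.injective ?_
  simp only [ContinuousLinearEquiv.coe_coe, ContinuousLinearEquiv.apply_symm_apply]
  ext w
  rw [← metricInChart_gradientInChart g hf he hy w, ← hL]
  rfl

/-- If `g(∇f, ∇f)` is maximal at a point, then `∇_{∇f} ∇f` vanishes there. -/
theorem metricInChart_fderiv_gradientInChart_add_christoffel
    (hf : ContMDiff 𝓘(ℝ, E) 𝓘(ℝ, ℝ) ∞ f)
    (he : e ∈ IsManifold.maximalAtlas 𝓘(ℝ, E) ∞ M) {y : E} (hy : y ∈ e.target)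
    (hmax : ∀ x : M, g.inner x (gradient g f x) (gradient g f x)
      ≤ g.inner (e.symm y) (gradient g f (e.symm y)) (gradient g f (e.symm y))) (w : E) :
    metricInChart g e y (fderiv ℝ (gradientInChart g f e) y (gradientInChart g f e y)) w
      + christoffel g e y (gradientInChart g f e y) (gradientInChart g f e y) w = 0 := by
  have hnhds : e.target ∈ nhds y := e.open_target.mem_nhds hy
  have key := gradient_geodesic_identity (G := metricInChart g e) (V := gradientInChart g f e)
    (φ := fun y ↦ f (e.symm y)) (y := y)
    (((contDiffOn_metricInChart g he).contDiffAt hnhds).differentiableAt (by simp))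
    (((contDiffOn_gradientInChart g hf he).contDiffAt hnhds).differentiableAt (by simp))
    (((contDiffOn_comp_symm hf he).contDiffAt hnhds).of_le (WithTop.coe_le_coe.2 (le_top (a := (2 : ℕ∞)))))
    (metricInChart_symm g e y)
    (by
      filter_upwards [hnhds] with z hz w
      exact metricInChart_gradientInChart g hf he hz w)
    (by
      filter_upwards [hnhds] with z hz
      rw [metricInChart_gradientInChart_self g he hz, metricInChart_gradientInChart_self g he hy]
      exact hmax _) w
  -- For equal first two arguments, `Γ(V,V;w) = D_V G(V,w) - ½ D_w G(V,V)`, which turns `key` into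
  -- the claim.
  rw [christoffel]
  linarith

end ChartCalculus

theorem hasDerivWithinAt_of_hasMFDerivWithinAt {F : Type*} [NormedAddCommGroup F]
    [NormedSpace ℝ F] {c : ℝ → F} {s : Set ℝ} {r : ℝ} {L : ℝ →L[ℝ] F}
    (h : HasMFDerivWithinAt 𝓘(ℝ, ℝ) 𝓘(ℝ, F) c s r L) : HasDerivWithinAt c (L 1) s r := by
  have h' : HasFDerivWithinAt c L s r := hasMFDerivWithinAt_iff_hasFDerivWithinAt.1 h
  exact h'.hasDerivWithinAt

/-! ### Integral curves of the gradient as null geodesics -/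

section GradientCurves

theorem velocity_eq_of_isMIntegralCurveOn {E : Type*} [NormedAddCommGroup E] [NormedSpace ℝ E]
    {M : Type*} [TopologicalSpace M] [ChartedSpace E M] {σ : ℝ → M} {s : Set ℝ}
    (hs : UniqueDiffOn ℝ s)
    {X : ∀ x : M, TangentSpace 𝓘(ℝ, E) x}
    (hσ : IsMIntegralCurveOn (I := 𝓘(ℝ, E)) σ X s) {t : ℝ} (ht : t ∈ s) :
    velocity (E := E) σ s t = X (σ t) := by
  rw [velocity, (hσ t ht).mfderivWithin (hs t ht).uniqueMDiffWithinAt]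
  exact one_smul ℝ (X (σ t))

variable {E : Type*} [NormedAddCommGroup E] [NormedSpace ℝ E] [FiniteDimensional ℝ E]
  {M : Type*} [TopologicalSpace M] [ChartedSpace E M] [IsManifold 𝓘(ℝ, E) ∞ M]
  {g : LorentzMetric E M} {e : OpenPartialHomeomorph M E} {f : M → ℝ} {σ : ℝ → M} {s : Set ℝ}

theorem hasDerivWithinAt_chart_comp_of_isMIntegralCurveOn
    (he : e ∈ IsManifold.maximalAtlas 𝓘(ℝ, E) ∞ M)
    (hσ : IsMIntegralCurveOn (I := 𝓘(ℝ, E)) σ (gradient g f) s) {r : ℝ} (hr : r ∈ s)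
    (hre : σ r ∈ e.source) :
    HasDerivWithinAt (fun r ↦ e (σ r)) (gradientInChart g f e (e (σ r))) s r := by
  have h1 := ((mdifferentiable_of_mem_maximalAtlas he).mdifferentiableAt
    hre).hasMFDerivAt.comp_hasMFDerivWithinAt r (hσ r hr)
  have h2 := hasDerivWithinAt_of_hasMFDerivWithinAt h1
  have h3 : gradientInChart g f e (e (σ r))
      = mfderiv 𝓘(ℝ, E) 𝓘(ℝ, E) e (σ r) (gradient g f (σ r)) :=
    congrArg (fun x ↦ (mfderiv 𝓘(ℝ, E) 𝓘(ℝ, E) e x (gradient g f x) : E)) (e.left_inv hre)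
  have h4 : mfderiv 𝓘(ℝ, E) 𝓘(ℝ, E) e (σ r) ((1 : ℝ) • gradient g f (σ r))
      = gradientInChart g f e (e (σ r)) := by rw [h3, one_smul]
  rw [← h4]
  exact h2

theorem inter_preimage_source_mem_nhdsWithin
    (hσ : IsMIntegralCurveOn (I := 𝓘(ℝ, E)) σ (gradient g f) s) {t : ℝ} (ht : t ∈ s)
    (hte : σ t ∈ e.source) : s ∩ σ ⁻¹' e.source ∈ nhdsWithin t s :=
  Filter.inter_mem self_mem_nhdsWithin
    ((hσ t ht).continuousWithinAt (e.open_source.mem_nhds hte))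

/-- Supplies the `C²` regularity demanded of geodesics, by ODE bootstrapping in the chart at each
point. -/
theorem contMDiffOn_two_of_isMIntegralCurveOn (hf : ContMDiff 𝓘(ℝ, E) 𝓘(ℝ, ℝ) ∞ f)
    (hσ : IsMIntegralCurveOn (I := 𝓘(ℝ, E)) σ (gradient g f) s) :
    ContMDiffOn 𝓘(ℝ, ℝ) 𝓘(ℝ, E) 2 σ s := by
  intro t ht
  rw [contMDiffWithinAt_iff_target]
  refine ⟨(hσ t ht).continuousWithinAt, contMDiffWithinAt_iff_contDiffWithinAt.2 ?_⟩
  have he : chartAt E (σ t) ∈ IsManifold.maximalAtlas 𝓘(ℝ, E) ∞ M :=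
    IsManifold.chart_mem_maximalAtlas _
  have hte := mem_chart_source E (σ t)
  have hmem := inter_preimage_source_mem_nhdsWithin hσ ht hte
  have htarget : chartAt E (σ t) (σ t) ∈ (chartAt E (σ t)).target :=
    (chartAt E (σ t)).map_source hte
  have := contDiffWithinAt_two_of_hasDerivWithinAt (V := gradientInChart g f (chartAt E (σ t)))
    (c := fun r ↦ chartAt E (σ t) (σ r)) (s := s ∩ σ ⁻¹' (chartAt E (σ t)).source)
    (t := t) ⟨ht, hte⟩
    (((contDiffOn_gradientInChart g hf he).contDiffAt
      ((chartAt E (σ t)).open_target.mem_nhds htarget)).of_le (by simp))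
    (fun r hr ↦ (hasDerivWithinAt_chart_comp_of_isMIntegralCurveOn he hσ hr.1 hr.2).mono
      inter_subset_left)
  exact this.mono_of_mem_nhdsWithin hmem

/-- If `g(∇f, ∇f) ≤ 0` everywhere, then the integral curves of `∇f` along which `∇f` is null are
null geodesics. -/
theorem isNullGeodesicOn_of_isMIntegralCurveOn (hs : UniqueDiffOn ℝ s)
    (hf : ContMDiff 𝓘(ℝ, E) 𝓘(ℝ, ℝ) ∞ f)
    (hσ : IsMIntegralCurveOn (I := 𝓘(ℝ, E)) σ (gradient g f) s)
    (hle : ∀ x : M, g.inner x (gradient g f x) (gradient g f x) ≤ 0)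
    (hnull : ∀ t ∈ s, IsNull g (gradient g f (σ t))) :
    IsNullGeodesicOn g σ s := by
  refine ⟨⟨contMDiffOn_two_of_isMIntegralCurveOn hf hσ, ?_⟩, fun t ht ↦ ?_⟩
  · intro e he t ht hte w c
    have hmem := inter_preimage_source_mem_nhdsWithin hσ ht hte
    have htarget : c t ∈ e.target := e.map_source hte
    have hc (r : ℝ) (hr : r ∈ s ∩ σ ⁻¹' e.source) :
        HasDerivWithinAt c (gradientInChart g f e (c r)) s r :=
      hasDerivWithinAt_chart_comp_of_isMIntegralCurveOn he hσ hr.1 hr.2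
    have hc' (r : ℝ) (hr : r ∈ s ∩ σ ⁻¹' e.source) :
        derivWithin c s r = gradientInChart g f e (c r) := (hc r hr).derivWithin (hs r hr.1)
    have hV : HasFDerivAt (gradientInChart g f e)
        (fderiv ℝ (gradientInChart g f e) (c t)) (c t) :=
      (((contDiffOn_gradientInChart g hf he).contDiffAt
        (e.open_target.mem_nhds htarget)).differentiableAt (by simp)).hasFDerivAt
    -- Differentiating `c' = V ∘ c`, valid near `t` within `s`, gives `c'' = DV(V)`.
    have hc'' := ((hV.comp_hasDerivWithinAt t (hc t ⟨ht, hte⟩)).congr_of_eventuallyEq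
      (Filter.eventually_of_mem hmem hc') (hc' t ⟨ht, hte⟩)).derivWithin (hs t ht)
    rw [hc'', hc' t ⟨ht, hte⟩]
    refine metricInChart_fderiv_gradientInChart_add_christoffel hf he htarget (fun x ↦ ?_) w
    have hct : e.symm (c t) = σ t := e.left_inv hte
    rw [hct, (hnull t ht).2]
    exact hle x
  · rw [velocity_eq_of_isMIntegralCurveOn hs hσ ht]
    exact hnull t ht

theorem gradient_neg (g : LorentzMetric E M) (f : M → ℝ) (x : M) :
    gradient g (fun x ↦ -f x) x = -gradient g f x := by
  rw [← sub_eq_zero]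
  refine g.nondegenerate x _ fun w ↦ ?_
  rw [map_sub, sub_apply, map_neg, neg_apply, inner_gradient, inner_gradient]
  have : mfderiv 𝓘(ℝ, E) 𝓘(ℝ, ℝ) (fun x ↦ -f x) x = -mfderiv 𝓘(ℝ, E) 𝓘(ℝ, ℝ) f x :=
    mfderiv_neg
  rw [this]
  exact sub_self _

/-- The derivative of a function along a curve. -/
theorem hasDerivWithinAt_comp_curve (hf : ContMDiff 𝓘(ℝ, E) 𝓘(ℝ, ℝ) ∞ f) {r : ℝ}
    (hσ : MDifferentiableWithinAt 𝓘(ℝ, ℝ) 𝓘(ℝ, E) σ s r) :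
    HasDerivWithinAt (fun r ↦ f (σ r))
      (g.inner (σ r) (gradient g f (σ r)) (velocity σ s r)) s r := by
  have h1 := (hf.mdifferentiable (by simp) (σ r)).hasMFDerivAt.comp_hasMFDerivWithinAt r
    hσ.hasMFDerivWithinAt
  rw [inner_gradient]
  exact hasDerivWithinAt_of_hasMFDerivWithinAt h1

end GradientCurves

/-! ### Reparametrizing and joining integral curves -/

section Reparametrization

/-- Change of parameter `τ` with `τ' = 1 / ρ(τ)`. -/
theorem exists_reparametrization {p q : ℝ} (hpq : p < q) {ρ : ℝ → ℝ}
    (hρ : ContinuousOn ρ (Icc p q)) (hpos : ∀ t ∈ Icc p q, 0 < ρ t) (A : ℝ) :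
    ∃ B > A, ∃ τ : ℝ → ℝ, τ A = p ∧ τ B = q ∧
      ∀ s ∈ Icc A B, τ s ∈ Icc p q ∧ HasDerivAt τ (ρ (τ s))⁻¹ s := by
  obtain ⟨t₀, ht₀, hmin⟩ := isCompact_Icc.exists_isMinOn (nonempty_Icc.2 hpq.le) hρ
  -- `μ` extends `ρ` by its end values, so its primitive `S` is defined on the whole line; a
  -- positive lower bound for the slope makes `S` bijective, and `τ` is its inverse.
  set μ : ℝ → ℝ := IccExtend hpq.le ((Icc p q).domRestrict ρ)
  have hμ : Continuous μ := (continuousOn_iff_continuous_domRestrict.1 hρ).Icc_extend'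
  have hμmin (t : ℝ) : ρ t₀ ≤ μ t := hmin (projIcc p q hpq.le t).2
  have hm : 0 < ρ t₀ := hpos t₀ ht₀
  have hμρ (t : ℝ) (ht : t ∈ Icc p q) : μ t = ρ t := IccExtend_of_mem hpq.le _ ht
  set S : ℝ → ℝ := fun t ↦ A + ∫ x in p..t, μ x
  have hS (t : ℝ) : HasDerivAt S (μ t) t :=
    (intervalIntegral.integral_hasDerivAt_right (hμ.intervalIntegrable _ _)
      (hμ.stronglyMeasurableAtFilter _ _) hμ.continuousAt).const_add A
  have hgrow (x y : ℝ) (hxy : x ≤ y) : ρ t₀ * (y - x) ≤ S y - S x :=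
    mul_sub_le_image_sub_of_le_deriv (fun t ↦ (hS t).differentiableAt)
      (fun t ↦ by rw [(hS t).deriv]; exact hμmin t) hxy
  have hmono : StrictMono S := fun x y hxy ↦ by
    have := hgrow x y hxy.le
    nlinarith [mul_pos hm (sub_pos.2 hxy)]
  have hcont : Continuous S := continuous_iff_continuousAt.2 fun t ↦ (hS t).continuousAt
  have hsurj : Function.Surjective S := by
    refine hcont.surjective ?_ ?_
    · refine Filter.tendsto_atTop_mono' _ ?_ (Filter.tendsto_atTop_add_const_left _ (S 0)
        (Filter.tendsto_id.const_mul_atTop hm))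
      filter_upwards [Filter.eventually_ge_atTop 0] with t ht
      have := hgrow 0 t ht
      simp only [id]
      linarith
    · refine Filter.tendsto_atBot_mono' _ ?_ (Filter.tendsto_atBot_add_const_left _ (S 0)
        (Filter.tendsto_id.const_mul_atBot hm))
      filter_upwards [Filter.eventually_le_atBot 0] with t ht
      have := hgrow t 0 ht
      simp only [id]
      linarith
  let o : ℝ ≃o ℝ := hmono.orderIsoOfSurjective S hsurj
  have ho (t : ℝ) : o t = S t := rfl
  have hSp : S p = A := by simp [S]
  refine ⟨S q, by rw [← hSp]; exact hmono hpq, o.symm, ?_, ?_, fun s hs ↦ ?_⟩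
  · rw [OrderIso.symm_apply_eq, ho, hSp]
  · rw [OrderIso.symm_apply_eq, ho]
  · have hmem : o.symm s ∈ Icc p q := by
      rw [mem_Icc, OrderIso.le_symm_apply, OrderIso.symm_apply_le, ho, ho, hSp]
      exact hs
    refine ⟨hmem, ?_⟩
    rw [← hμρ _ hmem]
    exact HasDerivAt.of_local_left_inverse o.symm.continuous.continuousAt (hS _)
      (hm.trans_le (hμmin _)).ne' (Filter.Eventually.of_forall fun y ↦ o.apply_symm_apply y)

variable {E : Type*} [NormedAddCommGroup E] [NormedSpace ℝ E]
  {M : Type*} [TopologicalSpace M] [ChartedSpace E M]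
  {X : ∀ x : M, TangentSpace 𝓘(ℝ, E) x}

/-- A curve whose velocity is a positive multiple of a vector field can be reparametrized as an
integral curve. -/
theorem exists_isMIntegralCurveOn_comp {γ : ℝ → M} {p q : ℝ} (hpq : p < q) {ρ : ℝ → ℝ}
    (hρ : ContinuousOn ρ (Icc p q)) (hpos : ∀ t ∈ Icc p q, 0 < ρ t)
    (hγ : MDifferentiableOn 𝓘(ℝ, ℝ) 𝓘(ℝ, E) γ (Icc p q))
    (hvel : ∀ t ∈ Icc p q, velocity γ (Icc p q) t = ρ t • X (γ t)) (A : ℝ) :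
    ∃ B > A, ∃ τ : ℝ → ℝ, τ A = p ∧ τ B = q ∧ MapsTo τ (Icc A B) (Icc p q) ∧
      IsMIntegralCurveOn (I := 𝓘(ℝ, E)) (γ ∘ τ) X (Icc A B) := by
  obtain ⟨B, hB, τ, hA, hBq, hτ⟩ := exists_reparametrization hpq hρ hpos A
  refine ⟨B, hB, τ, hA, hBq, fun s hs ↦ (hτ s hs).1, fun s hs ↦ ?_⟩
  let D : ℝ →L[ℝ] E := mfderivWithin 𝓘(ℝ, ℝ) 𝓘(ℝ, E) γ (Icc p q) (τ s)
  let v : E := X (γ (τ s))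
  let R : ℝ →L[ℝ] ℝ := (1 : ℝ →L[ℝ] ℝ).smulRight (ρ (τ s))⁻¹
  have hR : HasFDerivWithinAt τ R (Icc A B) s := by
    simpa using! (hτ s hs).2.hasDerivWithinAt.hasFDerivWithinAt
  have hτ' : HasMFDerivWithinAt 𝓘(ℝ, ℝ) 𝓘(ℝ, ℝ) τ (Icc A B) s R :=
    hasMFDerivWithinAt_iff_hasFDerivWithinAt.2 hR
  have h1 := (hγ (τ s) (hτ s hs).1).hasMFDerivWithinAt.comp s hτ' (fun r hr ↦ (hτ r hr).1)
  have hD : D 1 = ρ (τ s) • v := hvel _ (hτ s hs).1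
  -- Chain rule: the factor `ρ⁻¹` from `τ'` cancels the `ρ` in the velocity of `γ`.
  have h5 : (1 : ℝ →L[ℝ] ℝ).smulRight v = D.comp R := by
    refine ContinuousLinearMap.ext_ring ?_
    have h4 : R 1 = (ρ (τ s))⁻¹ • (1 : ℝ) := by simp [R]
    rw [ContinuousLinearMap.comp_apply, h4, map_smul, hD, smul_smul,
      inv_mul_cancel₀ (hpos _ (hτ s hs).1).ne']
    simp
  exact (congrArg (fun L : ℝ →L[ℝ] E ↦
    HasMFDerivWithinAt 𝓘(ℝ, ℝ) 𝓘(ℝ, E) (γ ∘ τ) (Icc A B) s L) h5).mpr h1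

theorem hasMFDerivWithinAt_smulRight_congr {σ σ₁ : ℝ → M} {u : Set ℝ} {r : ℝ}
    (h : HasMFDerivWithinAt 𝓘(ℝ, ℝ) 𝓘(ℝ, E) σ₁ u r
      ((1 : ℝ →L[ℝ] ℝ).smulRight (X (σ₁ r)))) (heq : ∀ x ∈ u, σ x = σ₁ x) (hr : σ r = σ₁ r) :
    HasMFDerivWithinAt 𝓘(ℝ, ℝ) 𝓘(ℝ, E) σ u r ((1 : ℝ →L[ℝ] ℝ).smulRight (X (σ r))) := by
  have hX : ((1 : ℝ →L[ℝ] ℝ).smulRight (X (σ r)) : ℝ →L[ℝ] E)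
      = (1 : ℝ →L[ℝ] ℝ).smulRight (X (σ₁ r)) :=
    congrArg (fun x ↦ ((1 : ℝ →L[ℝ] ℝ).smulRight (X x) : ℝ →L[ℝ] E)) hr
  rw [show HasMFDerivWithinAt 𝓘(ℝ, ℝ) 𝓘(ℝ, E) σ u r ((1 : ℝ →L[ℝ] ℝ).smulRight (X (σ r)))
    ↔ HasMFDerivWithinAt 𝓘(ℝ, ℝ) 𝓘(ℝ, E) σ u r ((1 : ℝ →L[ℝ] ℝ).smulRight (X (σ₁ r)))
    from iff_of_eq (congrArg (fun L : ℝ →L[ℝ] E ↦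
      HasMFDerivWithinAt 𝓘(ℝ, ℝ) 𝓘(ℝ, E) σ u r L) hX)]
  exact h.congr_of_eventuallyEq (Filter.eventually_of_mem self_mem_nhdsWithin heq) hr

/-- At the joint both one-sided derivatives equal the value of `X` at the common point, so they form
a two-sided derivative. -/
theorem isMIntegralCurveOn_Icc_concat {σ₁ σ₂ : ℝ → M} {a b c : ℝ} (hab : a ≤ b) (hbc : b ≤ c)
    (h₁ : IsMIntegralCurveOn (I := 𝓘(ℝ, E)) σ₁ X (Icc a b))
    (h₂ : IsMIntegralCurveOn (I := 𝓘(ℝ, E)) σ₂ X (Icc b c)) (hb : σ₁ b = σ₂ b) :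
    IsMIntegralCurveOn (I := 𝓘(ℝ, E)) (fun s ↦ if s ≤ b then σ₁ s else σ₂ s) X (Icc a c) := by
  set σ : ℝ → M := fun s ↦ if s ≤ b then σ₁ s else σ₂ s
  have e₁ (x : ℝ) (hx : x ∈ Icc a b) : σ x = σ₁ x := if_pos hx.2
  have e₂ (x : ℝ) (hx : x ∈ Icc b c) : σ x = σ₂ x := by
    rcases hx.1.eq_or_lt with rfl | h
    · exact (if_pos le_rfl).trans hb
    · exact if_neg (not_le.2 h)
  have d₁ (r : ℝ) (hr : r ∈ Icc a b) := hasMFDerivWithinAt_smulRight_congr (h₁ r hr) e₁ (e₁ r hr)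
  have d₂ (r : ℝ) (hr : r ∈ Icc b c) := hasMFDerivWithinAt_smulRight_congr (h₂ r hr) e₂ (e₂ r hr)
  intro r hr
  rcases lt_trichotomy r b with h | rfl | h
  · refine (d₁ r ⟨hr.1, h.le⟩).mono_of_mem_nhdsWithin ?_
    filter_upwards [self_mem_nhdsWithin, mem_nhdsWithin_of_mem_nhds (Iio_mem_nhds h)] with x hx hx'
    exact ⟨hx.1, le_of_lt hx'⟩
  · rw [← Icc_union_Icc_eq_Icc hab hbc]
    exact (d₁ r ⟨hab, le_rfl⟩).union (d₂ r ⟨le_rfl, hbc⟩)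
  · refine (d₂ r ⟨h.le, hr.2⟩).mono_of_mem_nhdsWithin ?_
    filter_upwards [self_mem_nhdsWithin, mem_nhdsWithin_of_mem_nhds (Ioi_mem_nhds h)] with x hx hx'
    exact ⟨le_of_lt hx', hx.2⟩

/-- A chain of integral curve segments through a set `N` can be joined to a single one. -/
theorem exists_isMIntegralCurveOn_of_chain {N : Set M} {x : ℕ → M} {n : ℕ}
    (h : ∀ i < n, ∀ A : ℝ, ∃ B > A, ∃ σ : ℝ → M, σ A = x i ∧ σ B = x (i + 1) ∧
      MapsTo σ (Icc A B) N ∧ IsMIntegralCurveOn (I := 𝓘(ℝ, E)) σ X (Icc A B)) (hn : 0 < n) (A : ℝ) :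
    ∃ B > A, ∃ σ : ℝ → M, σ A = x 0 ∧ σ B = x n ∧
      MapsTo σ (Icc A B) N ∧ IsMIntegralCurveOn (I := 𝓘(ℝ, E)) σ X (Icc A B) := by
  -- The induction starts at one segment, since an empty chain would not give `B > A`.
  suffices ∀ k, 1 ≤ k → k ≤ n → ∃ B > A, ∃ σ : ℝ → M, σ A = x 0 ∧ σ B = x k ∧
      MapsTo σ (Icc A B) N ∧ IsMIntegralCurveOn (I := 𝓘(ℝ, E)) σ X (Icc A B) from
    this n hn le_rfl
  intro k hk
  induction k, hk using Nat.le_induction with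
  | base => exact fun hk ↦ h 0 hn A
  | succ k hk ih =>
    intro hkn
    obtain ⟨B, hB, σ₁, hA₁, hB₁, hN₁, h₁⟩ := ih (by omega)
    obtain ⟨C, hC, σ₂, hA₂, hB₂, hN₂, h₂⟩ := h k (by omega) B
    refine ⟨C, hB.trans hC, fun s ↦ if s ≤ B then σ₁ s else σ₂ s, ?_, ?_, fun s hs ↦ ?_,
      isMIntegralCurveOn_Icc_concat (le_of_lt hB) (le_of_lt hC) h₁ h₂ (hB₁.trans hA₂.symm)⟩
    · exact (if_pos (le_of_lt hB)).trans hA₁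
    · exact (if_neg (not_le.2 hC)).trans hB₂
    · dsimp only
      split_ifs with hsB
      · exact hN₁ ⟨hs.1, hsB⟩
      · exact hN₂ ⟨(not_le.1 hsB).le, hs.2⟩

end Reparametrization

/-! ### Monotonicity along causal curves and the conclusion -/

section Causality

variable {E : Type*} [NormedAddCommGroup E] [NormedSpace ℝ E]
  {M : Type*} [TopologicalSpace M] [ChartedSpace E M] [IsManifold 𝓘(ℝ, E) ∞ M]
  {g : LorentzMetric E M} {T : TimeOrientation g}

/-- The scalar product of two continuous vector fields along a curve is continuous. -/
theorem LorentzMetric.continuousOn_inner (g : LorentzMetric E M) {γ : ℝ → M}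
    {v w : ∀ t, TangentSpace 𝓘(ℝ, E) (γ t)} {s : Set ℝ}
    (hv : ContinuousOn (fun t ↦ (⟨γ t, v t⟩ : TangentBundle 𝓘(ℝ, E) M)) s)
    (hw : ContinuousOn (fun t ↦ (⟨γ t, w t⟩ : TangentBundle 𝓘(ℝ, E) M)) s) :
    ContinuousOn (fun t ↦ g.inner (γ t) (v t) (w t)) s := by
  intro t ht
  have hb : ContinuousWithinAt γ s t :=
    ((FiberBundle.continuousWithinAt_totalSpace (F := E) _).1 (hv t ht)).1
  have : ContinuousWithinAt (fun t ↦ Bundle.TotalSpace.mk' ℝ (E := Bundle.Trivial M ℝ) (γ t)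
      (g.inner (γ t) (v t) (w t))) s t := by
    apply ContinuousWithinAt.clm_bundle_apply₂ (F₁ := E) (F₂ := E)
    · exact g.contMDiff.continuous.continuousAt.comp_continuousWithinAt hb
    · exact hv t ht
    · exact hw t ht
  exact ((FiberBundle.continuousWithinAt_totalSpace (F := ℝ) _).1 this).2

theorem continuousOn_velocity {γ : ℝ → M} {p q : ℝ} (hpq : p < q)
    (hγ : ContMDiffOn 𝓘(ℝ, ℝ) 𝓘(ℝ, E) 1 γ (Icc p q)) :
    ContinuousOn (fun t ↦ (⟨γ t, velocity γ (Icc p q) t⟩ : TangentBundle 𝓘(ℝ, E) M))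
      (Icc p q) := by
  have h1 := hγ.continuousOn_tangentMapWithin le_rfl (uniqueDiffOn_Icc hpq).uniqueMDiffOn
  have h2 : Continuous (fun t : ℝ ↦ (⟨t, (1 : ℝ)⟩ : TangentBundle 𝓘(ℝ, ℝ) ℝ)) :=
    (contMDiff_vectorSpace_iff_contDiff (n := 0).2 (contDiff_const (c := (1 : ℝ)))).continuous
  exact h1.comp h2.continuousOn fun t ht ↦ ht

/-- The derivative of a smooth function in the direction of the time-orientation is continuous. -/
theorem TimeOrientation.continuous_inner_gradient [FiniteDimensional ℝ E] (T : TimeOrientation g)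
    {f : M → ℝ} (hf : ContMDiff 𝓘(ℝ, E) 𝓘(ℝ, ℝ) ∞ f) :
    Continuous fun x ↦ g.inner x (T.field x) (gradient g f x) := by
  have h1 := (hf.continuous_tangentMap (by simp)).comp T.continuous_field
  have h2 := (tangentBundleModelSpaceHomeomorph 𝓘(ℝ, ℝ)).continuous.comp h1
  refine (continuous_snd.comp h2).congr fun x ↦ ?_
  rw [g.symm, inner_gradient]
  simp only [Function.comp_apply, tangentBundleModelSpaceHomeomorph_coe]
  rfl

variable [FiniteDimensional ℝ E] {f : M → ℝ} {γ : ℝ → M} {p q : ℝ}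

/-- A function with past-directed causal gradient is nondecreasing along future-directed causal
curves. -/
theorem monotoneOn_comp_of_futureCausal (hf : ContMDiff 𝓘(ℝ, E) 𝓘(ℝ, ℝ) ∞ f)
    (hpast : ∀ x, T.PastCausal (gradient g f x))
    (hγ : MDifferentiableOn 𝓘(ℝ, ℝ) 𝓘(ℝ, E) γ (Icc p q))
    (hfut : ∀ r ∈ Icc p q, T.FutureCausal (velocity γ (Icc p q) r)) :
    MonotoneOn (fun t ↦ f (γ t)) (Icc p q) := by
  refine monotoneOn_of_hasDerivWithinAt_nonneg (convex_Icc p q)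
    (fun r hr ↦ (hasDerivWithinAt_comp_curve (g := g) hf (hγ r hr)).continuousWithinAt)
    (fun r hr ↦ (hasDerivWithinAt_comp_curve hf (hγ r (interior_subset hr))).mono interior_subset)
    (fun r hr ↦ (hpast _).inner_nonneg (hfut r (interior_subset hr)))

/-- A future-directed causal `C¹` curve along which a function with past-directed causal gradient
takes equal values at the end points is, up to reparametrization, an integral curve of `-∇f` through
points where `∇f` is null. -/
theorem exists_isMIntegralCurveOn_of_futureCausal (hf : ContMDiff 𝓘(ℝ, E) 𝓘(ℝ, ℝ) ∞ f)
    (hpast : ∀ x, T.PastCausal (gradient g f x)) (hpq : p < q)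
    (hγ : ContMDiffOn 𝓘(ℝ, ℝ) 𝓘(ℝ, E) 1 γ (Icc p q))
    (hfut : ∀ r ∈ Icc p q, T.FutureCausal (velocity γ (Icc p q) r)) (hle : f (γ q) ≤ f (γ p))
    (A : ℝ) :
    ∃ B > A, ∃ σ : ℝ → M, σ A = γ p ∧ σ B = γ q ∧
      MapsTo σ (Icc A B)
        {x | g.inner x (gradient g f x) (gradient g f x) = 0 ∧ f x = f (γ p)} ∧
      IsMIntegralCurveOn (I := 𝓘(ℝ, E)) σ (gradient g fun x ↦ -f x) (Icc A B) := by
  have hdiff : MDifferentiableOn 𝓘(ℝ, ℝ) 𝓘(ℝ, E) γ (Icc p q) := hγ.mdifferentiableOn (by simp)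
  have hmono := monotoneOn_comp_of_futureCausal hf hpast hdiff hfut
  have hp : p ∈ Icc p q := left_mem_Icc.2 hpq.le
  have hq : q ∈ Icc p q := right_mem_Icc.2 hpq.le
  have hconst (r : ℝ) (hr : r ∈ Icc p q) : f (γ r) = f (γ p) :=
    le_antisymm ((hmono hr hq hr.2).trans hle) (hmono hp hr hr.1)
  have hzero (r : ℝ) (hr : r ∈ Icc p q) :
      g.inner (γ r) (gradient g f (γ r)) (velocity γ (Icc p q) r) = 0 :=
    (uniqueDiffOn_Icc hpq r hr).eq_deriv _ (hasDerivWithinAt_comp_curve hf (hdiff r hr))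
      ((hasDerivWithinAt_const r (Icc p q) (f (γ p))).congr hconst (hconst r hr))
  have halg (r : ℝ) (hr : r ∈ Icc p q) :=
    (hpast (γ r)).eq_smul_of_inner_nonpos (hfut r hr) (hzero r hr).le
  -- The coefficient of the velocity with respect to `∇f` is negative; the sign makes `ρ` its
  -- positive coefficient with respect to `∇(-f)`.
  set ρ : ℝ → ℝ := fun r ↦ -(g.inner (γ r) (T.field (γ r)) (velocity γ (Icc p q) r)
    / g.inner (γ r) (T.field (γ r)) (gradient g f (γ r)))
  have hρ : ContinuousOn ρ (Icc p q) :=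
    (ContinuousOn.div
      (g.continuousOn_inner (T.continuous_field.comp_continuousOn hγ.continuousOn)
        (continuousOn_velocity hpq hγ))
      ((T.continuous_inner_gradient hf).comp_continuousOn hγ.continuousOn)
      (fun r _ ↦ (hpast (γ r)).2.ne')).neg
  obtain ⟨B, hB, τ, hA, hBq, hmaps, hint⟩ := exists_isMIntegralCurveOn_comp
    (X := gradient g fun x ↦ -f x) hpq hρ
    (fun r hr ↦ neg_pos.2 (div_neg_of_neg_of_pos (hfut r hr).2 (hpast (γ r)).2)) hdiff
    (fun r hr ↦ by rw [gradient_neg, smul_neg, neg_smul, neg_neg]; exact (halg r hr).2.2) A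
  exact ⟨B, hB, γ ∘ τ, congrArg γ hA, congrArg γ hBq,
    fun s hs ↦ ⟨(halg _ (hmaps hs)).1, hconst _ (hmaps hs)⟩, hint⟩

theorem IsQuasiTimeFunction.isCausal (h : IsQuasiTimeFunction T f) : IsCausal T := by
  rintro ⟨γ, a, b, hab, ⟨n, t, rfl, rfl, hpieces⟩, hclosed⟩
  have hn : 0 < n := Nat.pos_of_ne_zero fun h0 ↦ by simp [h0] at hab
  have hstep (i : ℕ) (hi : i < n) : f (γ (t i)) ≤ f (γ (t (i + 1))) := by
    obtain ⟨hlt, hC, hfut⟩ := hpieces i hi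
    exact monotoneOn_comp_of_futureCausal h.smooth h.gradient_pastCausal
      (hC.mdifferentiableOn (by simp)) hfut (left_mem_Icc.2 hlt.le) (right_mem_Icc.2 hlt.le) hlt.le
  have hmono (i j : ℕ) (hij : i ≤ j) (hj : j ≤ n) : f (γ (t i)) ≤ f (γ (t j)) := by
    induction j, hij using Nat.le_induction with
    | base => exact le_rfl
    | succ k _ ih => exact (ih (by omega)).trans (hstep k (by omega))
  -- Monotonicity squeezes each value between those at the two ends, which agree because the curve
  -- is closed.
  have hconst (i : ℕ) (hi : i ≤ n) : f (γ (t i)) = f (γ (t 0)) :=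
    le_antisymm ((hmono i n hi le_rfl).trans_eq (congrArg f hclosed.symm))
      (hmono 0 i (Nat.zero_le _) hi)
  obtain ⟨B, hB, σ, hA, hBn, hmaps, hint⟩ := exists_isMIntegralCurveOn_of_chain
    (N := {x | g.inner x (gradient g f x) (gradient g f x) = 0 ∧ f x = f (γ (t 0))})
    (x := fun i ↦ γ (t i)) (X := gradient g fun x ↦ -f x) (n := n)
    (fun i hi A ↦ by
      obtain ⟨hlt, hC, hfut⟩ := hpieces i hi
      have := exists_isMIntegralCurveOn_of_futureCausal h.smooth h.gradient_pastCausal hlt hC hfut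
        (by rw [hconst i hi.le, hconst (i + 1) hi]) A
      rwa [hconst i hi.le] at this) hn 0
  have hself (x : M) : g.inner x (gradient g (fun x ↦ -f x) x) (gradient g (fun x ↦ -f x) x)
      = g.inner x (gradient g f x) (gradient g f x) := by
    rw [gradient_neg, (g.inner x (-gradient g f x)).map_neg, g.symm,
      (g.inner x (gradient g f x)).map_neg, neg_neg]
  -- The geodesic criterion is applied to `-f`, whose gradient has the same square as `∇f`.
  have hgeo : IsNullGeodesicOn g σ (Icc 0 B) := by
    refine isNullGeodesicOn_of_isMIntegralCurveOn (uniqueDiffOn_Icc hB) h.smooth.neg hint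
      (fun x ↦ ?_) (fun s hs ↦ ⟨?_, ?_⟩)
    · rw [hself]
      exact (h.gradient_pastCausal x).1.inner_self_nonpos
    · rw [gradient_neg, neg_ne_zero]
      exact h.gradient_ne_zero _
    · rw [hself]
      exact (hmaps hs).1
  have hinj := h.injOn_of_isNullGeodesicOn σ 0 B hB hgeo ⟨_, fun s hs ↦ (hmaps hs).2⟩
  exact hB.ne (hinj (left_mem_Icc.2 (le_of_lt hB)) (right_mem_Icc.2 (le_of_lt hB))
    (hA.trans (hclosed.trans hBn.symm)))

end Causality

end QuasiTime

/-- Any spacetime (time-oriented smooth Lorentzian manifold) that admits a quasi-time function is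
causal. -/
theorem proposition4p8 {E : Type*} [NormedAddCommGroup E] [NormedSpace ℝ E] [FiniteDimensional ℝ E]
    {M : Type*} [TopologicalSpace M] [T2Space M] [SecondCountableTopology M]
    [ChartedSpace E M] [IsManifold 𝓘(ℝ, E) ∞ M]
    (g : QuasiTime.LorentzMetric E M) (T : QuasiTime.TimeOrientation g)
    (h : ∃ f : M → ℝ, QuasiTime.IsQuasiTimeFunction T f) :
    QuasiTime.IsCausal T := by
  obtain ⟨f, hf⟩ := h
  exact hf.isCausal
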